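/- Let $\alpha,\lambda>0$ and $\beta\in(0,1)$, and let $X=(X_t)_{t\ge 0}$ be a tempered stable subordinator with parameters $(\alpha,\beta,\lambda)$, that is, a real-valued Lévy process ($X_0=0$ almost surely, independent and stationary increments, stochastically continuous, almost surely càdlàg paths) such that \[ \mathbb{E}\big[e^{izX_1}\big]=\exp\Big(\int_{\mathbb{R}}\big(e^{izx}-1\big)\,F(dx)\Big)\quad (z\in\mathbb{R}),\qquad F(dx)=\frac{\alpha}{x^{1+\beta}}\,e^{-\lambda x}\,\mathbb{1}_{(0,\infty)}(x)\,dx . \] Let $N=\sum_{s>0,\ \Delta X_s\neq 0}\delta_{(s,\Delta X_s)}$ be the random measure associated to the jumps $\Delta X_s=X_s-X_{s-}$ of $X$, let $\varphi_\beta(x)=(1+\beta x)^{-1/\beta}$ for $x\ge 0$, and for $n\in\mathbb{N}=\{1,2,\dots\}$ put \[ Y_n:=N\big((0,1]\times(\varphi_\beta(n+1),\varphi_\beta(n)]\big), \] the number of jumps of $X$ during $(0,1]$ whose size lies in $(\varphi_\beta(n+1),\varphi_\beta(n)]$. Then, almost surely, every $Y_n$ is finite and \[ \frac1n\sum_{j=1}^n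 Y_j\longrightarrow \alpha\qquad (n\to\infty). \] -/

import Mathlib

open MeasureTheory ProbabilityTheory Filter Topology
open scoped NNReal ENNReal

/-- A path `x : [0, ∞) → ℝ` is càdlàg: right-continuous with finite left limits. -/
def IsCadlagPath (x : ℝ≥0 → ℝ) : Prop :=
  ∀ t : ℝ≥0, ContinuousWithinAt x (Set.Ici t) t ∧ ∃ l : ℝ, Tendsto x (𝓝[<] t) (𝓝 l)

/-- `X` is a (real-valued) Lévy process on `[0, ∞)` under the probability measure `P`. -/
structure IsLevyProcess {Ω : Type*} [MeasurableSpace Ω] (P : Measure Ω) (X : ℝ≥0 → Ω → ℝ) :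
    Prop where
  measurable : ∀ t, Measurable (X t)
  start_zero : ∀ᵐ ω ∂P, X 0 ω = 0
  indep_increments : HasIndepIncrements X P
  stationary_increments : ∀ s h : ℝ≥0,
    IdentDistrib (fun ω => X (s + h) ω - X s ω) (fun ω => X h ω - X 0 ω) P P
  stochastically_continuous : ∀ t : ℝ≥0, TendstoInMeasure P X (𝓝 t) (X t)
  cadlag : ∀ᵐ ω ∂P, IsCadlagPath (fun t => X t ω)

/-- The Lévy measure `F(dx) = α x^{-(1+β)} e^{-λ x} 1_{(0,∞)}(x) dx`. -/
noncomputable def tsLevyMeasure (α β lam : ℝ) : Measure ℝ :=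
  (volume.restrict (Set.Ioi (0 : ℝ))).withDensity
    (fun x => ENNReal.ofReal (α / x ^ (1 + β) * Real.exp (-lam * x)))

/-- `η` is the one-sided tempered stable distribution `TS(α, β, λ)`: the probability measure with
characteristic function `z ↦ exp (∫ (e^{izx} - 1) F(dx))`. -/
structure IsTemperedStableLaw (η : Measure ℝ) (α β lam : ℝ) : Prop where
  isProbabilityMeasure : IsProbabilityMeasure η
  charFun_eq : ∀ z : ℝ, charFun η z =
    Complex.exp (∫ x : ℝ, (Complex.exp (Complex.I * (z : ℂ) * (x : ℂ)) - 1)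
      ∂(tsLevyMeasure α β lam))

/-- `X` is a tempered stable subordinator with parameters `α, β, λ`: the Lévy process
associated to `TS(α, β, λ)`, i.e. with `X₁ ∼ TS(α, β, λ)`. -/
structure IsTemperedStableSubordinator {Ω : Type*} [MeasurableSpace Ω] (P : Measure Ω)
    (X : ℝ≥0 → Ω → ℝ) (α β lam : ℝ) : Prop where
  isLevyProcess : IsLevyProcess P X
  law_one : IsTemperedStableLaw (P.map (X 1)) α β lam

/-- The jump `Δx_t = x_t - x_{t-}` of a path at time `t` (it is `0` at `t = 0`). -/
noncomputable def pathJump (x : ℝ≥0 → ℝ) (t : ℝ≥0) : ℝ := x t - Function.leftLim x t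

/-- The jump measure `∑_{s > 0, Δx_s ≠ 0} δ_{(s, Δx_s)}` of a path, on `[0, ∞) × ℝ`. -/
noncomputable def jumpMeasure (x : ℝ≥0 → ℝ) : Measure (ℝ≥0 × ℝ) :=
  Measure.sum fun s : {s : ℝ≥0 // 0 < s ∧ pathJump x s ≠ 0} =>
    Measure.dirac ((s : ℝ≥0), pathJump x s)

/-- `φ_β(x) = (1 + β x)^{-1/β}`. -/
noncomputable def phiLevel (β x : ℝ) : ℝ := (1 + β * x) ^ (-(1 / β))

/-- `Y_n = N((0,1] × (φ_β(n+1), φ_β(n)])`, where `N` is the random measure associated to the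
jumps of `X`. -/
noncomputable def jumpCount {Ω : Type*} (X : ℝ≥0 → Ω → ℝ) (β : ℝ) (n : ℕ) (ω : Ω) : ℝ≥0∞ :=
  jumpMeasure (fun t => X t ω)
    (Set.Ioc (0 : ℝ≥0) 1 ×ˢ Set.Ioc (phiLevel β ((n : ℝ) + 1)) (phiLevel β (n : ℝ)))

/-! Let `J n` be the number of jumps in `(0,1]` larger than `φ_β(n)`. The sum `Y_1 + ... + Y_n`
telescopes to `J (n+1) - J 1`, so the claim is `J n ~ α n`. Since `φ_β(n)^(-β) = 1 + β n`, the Lévy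
measure of `(φ_β(n), ∞)` is `α n + O(1)`; the law follows if `J n` concentrates around this mass.

The Poisson structure of the jumps is not used. Instead `J n` is compared with the number of dyadic
increments above a level. For a càdlàg path and fine meshes, this number is at least the size of any
finite set of jumps above the level, and at most the number of jumps above a slightly lower level
(`IsCadlagPath.eventually_card_le`, `IsCadlagPath.eventually_le_encard`).

At generation `k` the count is a sum of `2^k` i.i.d. indicators with mean `2^k P(X_{2^-k} > ε)`.
Fourier inversion shows that `2^k` times the law of `X_{2^-k}` converges to `F` away from `0`, so
for large `k` the mean at level `φ_β(n)` is within a constant of `α n`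
(`IsTemperedStableSubordinator.eventually_intensity`). Chernoff bounds then decay exponentially in
`n`, and Borel–Cantelli in `n`, applied to events holding for all large `k`, gives the asymptotics.
-/

/-! ### Jumps of a càdlàg path through its dyadic increments. -/

/-- The `j`-th dyadic time of generation `k`. -/
noncomputable def dyadicTime (k j : ℕ) : ℝ≥0 := (j : ℝ≥0) / 2 ^ k

lemma dyadicTime_mono (k : ℕ) : Monotone (dyadicTime k) := fun i j h => by
  unfold dyadicTime; gcongr

lemma dyadicTime_succ (k j : ℕ) : dyadicTime k (j + 1) = dyadicTime k j + dyadicTime k 1 := by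
  simp [dyadicTime, add_div]

lemma tendsto_dyadicTime_one : Tendsto (fun k => dyadicTime k 1) atTop (𝓝 0) := by
  have h : (fun k => dyadicTime k 1) = fun k => (2⁻¹ : ℝ≥0) ^ k := by
    ext k; simp [dyadicTime]
  rw [h]
  exact tendsto_pow_atTop_nhds_zero_of_lt_one zero_le (by
    rw [← NNReal.coe_lt_coe]; push_cast; norm_num)

open Classical in
/-- The dyadic cells of generation `k` in `(0, 1]` on which the path increases by more than `ε`. -/
noncomputable def dyadicExceedances (x : ℝ≥0 → ℝ) (ε : ℝ) (k : ℕ) : Finset ℕ :=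
  {j ∈ Finset.range (2 ^ k) | ε < x (dyadicTime k (j + 1)) - x (dyadicTime k j)}

/-- The times in `(0, 1]` of the jumps larger than `ε`. -/
def largeJumpTimes (x : ℝ≥0 → ℝ) (ε : ℝ) : Set ℝ≥0 := {s | s ∈ Set.Ioc 0 1 ∧ ε < pathJump x s}

/-- The index of the dyadic cell of generation `k` containing `t`. -/
noncomputable def dyadicIndex (t : ℝ≥0) (k : ℕ) : ℕ := ⌈t * 2 ^ k⌉₊ - 1

lemma dyadicIndex_add_one {t : ℝ≥0} (ht : 0 < t) (k : ℕ) :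
    dyadicIndex t k + 1 = ⌈t * 2 ^ k⌉₊ := by
  have : 0 < ⌈t * 2 ^ k⌉₊ := Nat.ceil_pos.2 (by positivity)
  unfold dyadicIndex; omega

lemma le_dyadicTime_dyadicIndex {t : ℝ≥0} (ht : 0 < t) (k : ℕ) :
    t ≤ dyadicTime k (dyadicIndex t k + 1) := by
  rw [dyadicIndex_add_one ht, dyadicTime, le_div_iff₀ (by positivity)]
  exact Nat.le_ceil _

lemma dyadicTime_dyadicIndex_lt {t : ℝ≥0} (ht : 0 < t) (k : ℕ) :
    dyadicTime k (dyadicIndex t k) < t := by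
  rw [dyadicTime, div_lt_iff₀ (by positivity)]
  apply Nat.lt_ceil.1
  have := dyadicIndex_add_one ht k
  omega

lemma dyadicIndex_lt {t : ℝ≥0} (ht : 0 < t) (ht1 : t ≤ 1) (k : ℕ) : dyadicIndex t k < 2 ^ k := by
  have h1 : ⌈t * 2 ^ k⌉₊ ≤ 2 ^ k := by
    apply Nat.ceil_le.2
    push_cast
    calc t * 2 ^ k ≤ 1 * 2 ^ k := by gcongr
      _ = 2 ^ k := one_mul _
  have := dyadicIndex_add_one ht k
  omega

lemma tendsto_dyadicTime_dyadicIndex {t : ℝ≥0} (ht : 0 < t) :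
    Tendsto (fun k => dyadicTime k (dyadicIndex t k)) atTop (𝓝[<] t) := by
  refine tendsto_nhdsWithin_iff.2 ⟨?_, Eventually.of_forall fun k => dyadicTime_dyadicIndex_lt ht k⟩
  have h : Tendsto (fun k => t - dyadicTime k 1) atTop (𝓝 (t - 0)) :=
    tendsto_const_nhds.sub tendsto_dyadicTime_one
  rw [tsub_zero] at h
  refine tendsto_of_tendsto_of_tendsto_of_le_of_le h tendsto_const_nhds (fun k => ?_)
    fun k => (dyadicTime_dyadicIndex_lt ht k).le
  have := le_dyadicTime_dyadicIndex ht k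
  rw [dyadicTime_succ] at this
  exact tsub_le_iff_right.2 this

lemma tendsto_dyadicTime_dyadicIndex_succ {t : ℝ≥0} (ht : 0 < t) :
    Tendsto (fun k => dyadicTime k (dyadicIndex t k + 1)) atTop (𝓝[≥] t) := by
  refine tendsto_nhdsWithin_iff.2 ⟨?_, Eventually.of_forall fun k => le_dyadicTime_dyadicIndex ht k⟩
  have h := ((tendsto_dyadicTime_dyadicIndex ht).mono_right nhdsWithin_le_nhds).add
    tendsto_dyadicTime_one
  simpa [← dyadicTime_succ] using h

lemma IsCadlagPath.leftLim_eq {x : ℝ≥0 → ℝ} {t : ℝ≥0} (ht : 0 < t) {l : ℝ}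
    (hl : Tendsto x (𝓝[<] t) (𝓝 l)) : Function.leftLim x t = l :=
  haveI : (𝓝[<] t).NeBot := nhdsLT_neBot_of_exists_lt ⟨0, ht⟩
  leftLim_eq_of_tendsto hl

lemma IsCadlagPath.tendsto_increment {x : ℝ≥0 → ℝ} (hx : IsCadlagPath x) {t : ℝ≥0} (ht : 0 < t) :
    Tendsto (fun k => x (dyadicTime k (dyadicIndex t k + 1)) - x (dyadicTime k (dyadicIndex t k)))
      atTop (𝓝 (pathJump x t)) := by
  obtain ⟨hr, l, hl⟩ := hx t
  rw [pathJump, IsCadlagPath.leftLim_eq ht hl]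
  exact (hr.tendsto.comp (tendsto_dyadicTime_dyadicIndex_succ ht)).sub
    (hl.comp (tendsto_dyadicTime_dyadicIndex ht))

lemma eventually_dyadicIndex_ne {s t : ℝ≥0} (hs : 0 < s) (ht : 0 < t) (hst : s ≠ t) :
    ∀ᶠ k in atTop, dyadicIndex s k ≠ dyadicIndex t k := by
  by_contra hcon
  have hf : ∃ᶠ k in atTop, dyadicIndex s k = dyadicIndex t k :=
    (not_eventually.1 hcon).mono fun k hk => not_not.1 hk
  have h := ((tendsto_dyadicTime_dyadicIndex hs).mono_right nhdsWithin_le_nhds).prodMk_nhds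
    ((tendsto_dyadicTime_dyadicIndex ht).mono_right nhdsWithin_le_nhds)
  have hd : ∀ᶠ p in 𝓝 (s, t), p.1 ≠ p.2 := isOpen_ne_fun continuous_fst continuous_snd
    |>.mem_nhds hst
  obtain ⟨k, h1, h2⟩ := (hf.and_eventually (h.eventually hd)).exists
  exact h2 (by simp [h1])

/-- The increment over the cell containing a jump time tends to the jump, and distinct times
eventually lie in distinct cells. Finiteness of `T` lets one `k` serve all its points. -/
lemma IsCadlagPath.eventually_card_le {x : ℝ≥0 → ℝ} (hx : IsCadlagPath x) {ε : ℝ}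
    {T : Finset ℝ≥0} (hT : ↑T ⊆ largeJumpTimes x ε) :
    ∀ᶠ k in atTop, T.card ≤ (dyadicExceedances x ε k).card := by
  have h1 : ∀ᶠ k in atTop, ∀ t ∈ T, ε < x (dyadicTime k (dyadicIndex t k + 1)) -
      x (dyadicTime k (dyadicIndex t k)) :=
    (Finset.eventually_all T).2 fun t ht =>
      (hx.tendsto_increment (hT ht).1.1).eventually_const_lt (hT ht).2
  have h2 : ∀ᶠ k in atTop, ∀ s ∈ T, ∀ t ∈ T, s ≠ t → dyadicIndex s k ≠ dyadicIndex t k :=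
    (Finset.eventually_all T).2 fun s hs => (Finset.eventually_all T).2 fun t ht => by
      by_cases hst : s = t
      · simp [hst]
      · filter_upwards [eventually_dyadicIndex_ne (hT hs).1.1 (hT ht).1.1 hst] with k hk _ using hk
  filter_upwards [h1, h2] with k hk1 hk2
  refine Finset.card_le_card_of_injOn (fun t => dyadicIndex t k) (fun t ht => ?_) ?_
  · simp only [dyadicExceedances, Finset.coe_filter, Set.mem_ofPred_eq, Finset.mem_range]
    exact ⟨dyadicIndex_lt (hT ht).1.1 (hT ht).1.2 k, hk1 t ht⟩
  · intro s hs t ht hst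
    by_contra hne
    exact hk2 s hs t ht hne hst

lemma IsCadlagPath.exists_oscillation {x : ℝ≥0 → ℝ} (hx : IsCadlagPath x) {η : ℝ} (hη : 0 < η)
    (t : ℝ≥0) : ∃ δ > 0, (∀ b ∈ Metric.ball t δ, t ≤ b → |x b - x t| < η) ∧
      ∀ a ∈ Metric.ball t δ, a < t → |x a - Function.leftLim x t| < η := by
  obtain ⟨hr, l, hl⟩ := hx t
  have h1 : ∀ᶠ b in 𝓝 t, t ≤ b → |x b - x t| < η :=
    eventually_nhdsWithin_iff.1 (hr.tendsto.eventually (Metric.ball_mem_nhds (x t) hη))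
  have h2 : ∀ᶠ a in 𝓝 t, a < t → |x a - l| < η :=
    eventually_nhdsWithin_iff.1 (hl.eventually (Metric.ball_mem_nhds l hη))
  obtain ⟨δ, hδ, h⟩ := Metric.eventually_nhds_iff_ball.1 (h1.and h2)
  refine ⟨δ, hδ, fun b hb => (h b hb).1, fun a ha hat => ?_⟩
  rw [IsCadlagPath.leftLim_eq (pos_of_gt hat) hl]
  exact (h a ha).2 hat

/-- By compactness (Lebesgue number), every short cell lies in a ball around some `t` on each side
of which the path stays within `(ε - ε') / 2` of its one-sided limit. Endpoints on the same side
differ by less than `ε - ε' ≤ ε`, so an exceedance must straddle `t`, and the jump there exceeds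
`ε'`. Disjointness of the cells makes these times distinct. -/
lemma IsCadlagPath.eventually_le_encard {x : ℝ≥0 → ℝ} (hx : IsCadlagPath x) {ε ε' : ℝ}
    (hε' : 0 ≤ ε') (hε : ε' < ε) :
    ∀ᶠ k in atTop, ((dyadicExceedances x ε k).card : ℕ∞) ≤ (largeJumpTimes x ε').encard := by
  choose δ hδ hr hl using hx.exists_oscillation (η := (ε - ε') / 2) (by linarith)
  obtain ⟨r, hr0, hball⟩ := lebesgue_number_lemma_of_metric (s := Set.Icc (0 : ℝ≥0) 1)
    (c := fun t => Metric.ball t (δ t)) isCompact_Icc (fun _ => Metric.isOpen_ball)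
    (fun t _ => Set.mem_iUnion.2 ⟨t, Metric.mem_ball_self (hδ t)⟩)
  have hsmall : ∀ᶠ k in atTop, (dyadicTime k 1 : ℝ) < r :=
    ((NNReal.tendsto_coe.2 tendsto_dyadicTime_one).eventually_lt_const (by simpa using hr0))
  filter_upwards [hsmall] with k hk
  have key : ∀ j ∈ dyadicExceedances x ε k, ∃ t ∈ largeJumpTimes x ε',
      dyadicTime k j < t ∧ t ≤ dyadicTime k (j + 1) := by
    intro j hj
    simp only [dyadicExceedances, Finset.mem_filter, Finset.mem_range] at hj
    obtain ⟨hj, hinc⟩ := hj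
    have hb1 : dyadicTime k (j + 1) ≤ 1 := by
      rw [dyadicTime, div_le_one (by positivity)]
      exact_mod_cast hj
    have hlt : dyadicTime k j ≤ dyadicTime k (j + 1) := dyadicTime_mono k (Nat.le_succ j)
    obtain ⟨t, ht⟩ := hball (dyadicTime k j) ⟨zero_le, hlt.trans hb1⟩
    have ha := ht (Metric.mem_ball_self hr0)
    have hb : dyadicTime k (j + 1) ∈ Metric.ball t (δ t) := by
      apply ht
      rw [Metric.mem_ball, NNReal.dist_eq, dyadicTime_succ]
      simpa using hk
    generalize dyadicTime k j = a at *
    generalize dyadicTime k (j + 1) = b at *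
    rcases le_or_gt t a with h | h
    · have h1 := abs_lt.1 (hr t a ha h)
      have h2 := abs_lt.1 (hr t b hb (h.trans hlt))
      linarith [h1.1, h2.2]
    rcases lt_or_ge b t with h' | h'
    · have h1 := abs_lt.1 (hl t a ha h)
      have h2 := abs_lt.1 (hl t b hb h')
      linarith [h1.1, h2.2]
    refine ⟨t, ⟨⟨pos_of_gt h, h'.trans hb1⟩, ?_⟩, h, h'⟩
    have h1 := abs_lt.1 (hl t a ha h)
    have h2 := abs_lt.1 (hr t b hb h')
    rw [pathJump]
    linarith [h1.1, h2.2]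
  choose! f hf1 hf2 hf3 using key
  rw [← Set.encard_coe_eq_coe_finsetCard]
  refine Set.encard_le_encard_of_injOn (f := f) (fun j hj => hf1 j hj) ?_
  intro i hi j hj hij
  by_contra hne
  rcases lt_or_gt_of_ne hne with h | h
  · have := (hf3 i hi).trans ((dyadicTime_mono k (Nat.succ_le_of_lt h)))
    exact (this.trans_lt (hf2 j hj)).ne hij
  · have := (hf3 j hj).trans ((dyadicTime_mono k (Nat.succ_le_of_lt h)))
    exact (this.trans_lt (hf2 i hi)).ne hij.symm

lemma jumpMeasure_prod_Ioi (x : ℝ≥0 → ℝ) {ε : ℝ} (hε : 0 ≤ ε) :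
    jumpMeasure x (Set.Ioc (0 : ℝ≥0) 1 ×ˢ Set.Ioi ε) = ((largeJumpTimes x ε).encard : ℝ≥0∞) := by
  have hm : MeasurableSet (Set.Ioc (0 : ℝ≥0) 1 ×ˢ Set.Ioi ε) :=
    measurableSet_Ioc.prod measurableSet_Ioi
  -- As `ε ≥ 0`, a jump above `ε` is nonzero, so its time belongs to the index set of `jumpMeasure`.
  have hsub : Function.support ((largeJumpTimes x ε).indicator fun _ => (1 : ℝ≥0∞)) ⊆
      {s : ℝ≥0 | 0 < s ∧ pathJump x s ≠ 0} := fun s hs =>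
    have hs' := Set.mem_of_indicator_ne_zero hs
    ⟨hs'.1.1, (hε.trans_lt hs'.2).ne'⟩
  rw [jumpMeasure, Measure.sum_apply _ hm, ← ENNReal.tsum_set_one,
    tsum_subtype (largeJumpTimes x ε) (fun _ => (1 : ℝ≥0∞))]
  refine Eq.trans (tsum_congr fun s => ?_) (tsum_subtype_eq_of_support_subset hsub)
  rw [Measure.dirac_apply' _ hm]
  rfl

/-! ### Chernoff bounds for the dyadic counts. -/

section

variable {Ω : Type*} [MeasurableSpace Ω] {P : Measure Ω} {X : ℝ≥0 → Ω → ℝ}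

lemma IsLevyProcess.map_increment (hX : IsLevyProcess P X) (s h : ℝ≥0) :
    P.map (fun ω => X (s + h) ω - X s ω) = P.map (X h) := by
  rw [(hX.stationary_increments s h).map_eq]
  refine Measure.map_congr ?_
  filter_upwards [hX.start_zero] with ω hω using by simp [hω]

lemma IsLevyProcess.map_dyadic_increment (hX : IsLevyProcess P X) (k j : ℕ) :
    P.map (fun ω => X (dyadicTime k (j + 1)) ω - X (dyadicTime k j) ω) =
      P.map (X (dyadicTime k 1)) := by
  rw [dyadicTime_succ]
  exact hX.map_increment _ _

lemma card_dyadicExceedances (x : ℝ≥0 → ℝ) (ε : ℝ) (k : ℕ) :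
    ((dyadicExceedances x ε k).card : ℝ) = ∑ j ∈ Finset.range (2 ^ k),
      (Set.Ioi ε).indicator 1 (x (dyadicTime k (j + 1)) - x (dyadicTime k j)) := by
  classical
  simp [dyadicExceedances, Set.indicator_apply]

lemma card_dyadicExceedances_le (x : ℝ≥0 → ℝ) (ε : ℝ) (k : ℕ) :
    ((dyadicExceedances x ε k).card : ℝ) ≤ 2 ^ k := by
  have h := Finset.card_filter_le (Finset.range (2 ^ k))
    (fun j => ε < x (dyadicTime k (j + 1)) - x (dyadicTime k j))
  rw [Finset.card_range] at h
  exact_mod_cast h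

lemma measurable_card_dyadicExceedances (hX : ∀ t, Measurable (X t)) (ε : ℝ) (k : ℕ) :
    Measurable fun ω => ((dyadicExceedances (fun t => X t ω) ε k).card : ℝ) := by
  simp_rw [card_dyadicExceedances]
  refine Finset.measurable_sum _ fun j _ => ?_
  exact (measurable_one.indicator measurableSet_Ioi).comp ((hX _).sub (hX _))

lemma integrable_exp_card_dyadicExceedances [IsProbabilityMeasure P]
    (hX : ∀ t, Measurable (X t)) (ε t : ℝ) (k : ℕ) :
    Integrable (fun ω => Real.exp (t * ((dyadicExceedances (fun s => X s ω) ε k).card : ℝ))) P := by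
  refine Integrable.of_bound (C := Real.exp (|t| * 2 ^ k))
    (((measurable_card_dyadicExceedances hX ε k).const_mul t).exp.aestronglyMeasurable)
    (Eventually.of_forall fun ω => ?_)
  rw [Real.norm_eq_abs, Real.abs_exp, Real.exp_le_exp]
  exact mul_le_mul (le_abs_self t) (card_dyadicExceedances_le _ _ _) (by positivity)
    (abs_nonneg t)

/-- The Bernoulli value `1 + p (e^t - 1)` is bounded by its Poisson counterpart through `1 + y ≤
e^y`. The sign of `t` is free, so both tails are covered. -/
lemma mgf_indicator_le [IsProbabilityMeasure P] {D : Ω → ℝ} (hD : Measurable D) (ε t : ℝ) :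
    mgf (fun ω => (Set.Ioi ε).indicator 1 (D ω)) P t ≤
      Real.exp ((P.map D).real (Set.Ioi ε) * (Real.exp t - 1)) := by
  have h : ∀ ω, Real.exp (t * (Set.Ioi ε).indicator 1 (D ω)) =
      (D ⁻¹' Set.Ioi ε).indicator (fun _ => Real.exp t - 1) ω + 1 := by
    intro ω
    by_cases hω : ε < D ω <;> simp [hω]
  have hs : MeasurableSet (D ⁻¹' Set.Ioi ε) := hD measurableSet_Ioi
  rw [mgf]
  simp_rw [h]
  rw [integral_add ((integrable_const _).indicator hs) (integrable_const _),
    integral_indicator_const _ hs, map_measureReal_apply hD measurableSet_Ioi]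
  simpa using Real.add_one_le_exp (P.real (D ⁻¹' Set.Ioi ε) * (Real.exp t - 1))

lemma IsLevyProcess.mgf_card_le [IsProbabilityMeasure P] (hX : IsLevyProcess P X) (ε t : ℝ)
    (k : ℕ) :
    mgf (fun ω => ((dyadicExceedances (fun s => X s ω) ε k).card : ℝ)) P t ≤
      Real.exp (2 ^ k * (P.map (X (dyadicTime k 1))).real (Set.Ioi ε) * (Real.exp t - 1)) := by
  set D : ℕ → Ω → ℝ := fun j ω => X (dyadicTime k (j + 1)) ω - X (dyadicTime k j) ω
  have hD : ∀ j, Measurable (D j) := fun j => (hX.measurable _).sub (hX.measurable _)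
  have hind : iIndepFun D P := hX.indep_increments.nat (dyadicTime_mono k)
  have hg : Measurable ((Set.Ioi ε).indicator (1 : ℝ → ℝ)) :=
    measurable_one.indicator measurableSet_Ioi
  have hsum : (fun ω => ((dyadicExceedances (fun s => X s ω) ε k).card : ℝ)) =
      ∑ j ∈ Finset.range (2 ^ k), (Set.Ioi ε).indicator 1 ∘ D j := by
    ext ω
    rw [card_dyadicExceedances, Finset.sum_apply]
    rfl
  rw [hsum, iIndepFun.mgf_sum (hind.comp (fun _ => (Set.Ioi ε).indicator 1) fun _ => hg)
    fun j => hg.comp (hD j)]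
  calc _ ≤ ∏ j ∈ Finset.range (2 ^ k),
        Real.exp ((P.map (X (dyadicTime k 1))).real (Set.Ioi ε) * (Real.exp t - 1)) := by
        refine Finset.prod_le_prod (fun _ _ => mgf_nonneg) fun j _ => ?_
        rw [← hX.map_dyadic_increment k j]
        exact mgf_indicator_le (hD j) ε t
    _ = _ := by
        rw [Finset.prod_const, Finset.card_range, ← Real.exp_nat_mul]
        push_cast
        ring_nf

lemma IsLevyProcess.chernoff_upper [IsProbabilityMeasure P] (hX : IsLevyProcess P X)
    {ε t u : ℝ} (ht : 0 ≤ t) (M : ℝ) {k : ℕ}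
    (hu : 2 ^ k * (P.map (X (dyadicTime k 1))).real (Set.Ioi ε) ≤ u) :
    P.real {ω | M ≤ ((dyadicExceedances (fun s => X s ω) ε k).card : ℝ)} ≤
      Real.exp (-t * M + u * (Real.exp t - 1)) := by
  refine (measure_ge_le_exp_mul_mgf M ht
    (integrable_exp_card_dyadicExceedances hX.measurable ε t k)).trans ?_
  rw [Real.exp_add]
  gcongr
  refine (hX.mgf_card_le ε t k).trans (Real.exp_le_exp.2 ?_)
  have : 0 ≤ Real.exp t - 1 := by linarith [Real.add_one_le_exp t]
  gcongr

lemma IsLevyProcess.chernoff_lower [IsProbabilityMeasure P] (hX : IsLevyProcess P X)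
    {ε t l : ℝ} (ht : 0 ≤ t) (M : ℝ) {k : ℕ}
    (hl : l ≤ 2 ^ k * (P.map (X (dyadicTime k 1))).real (Set.Ioi ε)) :
    P.real {ω | ((dyadicExceedances (fun s => X s ω) ε k).card : ℝ) ≤ M} ≤
      Real.exp (t * M + l * (Real.exp (-t) - 1)) := by
  refine (measure_le_le_exp_mul_mgf (t := -t) M (by linarith)
    (integrable_exp_card_dyadicExceedances hX.measurable ε (-t) k)).trans ?_
  rw [Real.exp_add, neg_neg]
  gcongr
  refine (hX.mgf_card_le ε (-t) k).trans (Real.exp_le_exp.2 ?_)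
  have : Real.exp (-t) - 1 ≤ 0 := by
    linarith [Real.exp_le_one_iff.2 (neg_nonpos.2 ht)]
  exact mul_le_mul_of_nonpos_right hl this

end

/-! ### Fourier proof that the rescaled laws converge to the Lévy measure. -/

section

open scoped FourierTransform SchwartzMap

/-- The exponent `z ↦ ∫ (e^{izx} - 1) F(dx)`. -/
noncomputable def levyExponent (F : Measure ℝ) (z : ℝ) : ℂ :=
  ∫ x : ℝ, (Complex.exp (Complex.I * (z : ℂ) * (x : ℂ)) - 1) ∂F

lemma norm_exp_I_mul_mul_sub_one_le (z x : ℝ) :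
    ‖Complex.exp (Complex.I * (z : ℂ) * (x : ℂ)) - 1‖ ≤ |z| * |x| := by
  have := Real.norm_exp_I_mul_ofReal_sub_one_le (x := z * x)
  rw [Real.norm_eq_abs, abs_mul] at this
  rwa [mul_assoc, ← Complex.ofReal_mul]

lemma integrable_exp_I_mul_mul_sub_one {F : Measure ℝ} (hF : Integrable (fun x : ℝ => x) F)
    (z : ℝ) : Integrable (fun x : ℝ => Complex.exp (Complex.I * (z : ℂ) * (x : ℂ)) - 1) F :=
  (hF.abs.const_mul |z|).mono' (by fun_prop)
    (Eventually.of_forall fun x => norm_exp_I_mul_mul_sub_one_le z x)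

lemma norm_levyExponent_le {F : Measure ℝ} (hF : Integrable (fun x : ℝ => x) F) (z : ℝ) :
    ‖levyExponent F z‖ ≤ |z| * ∫ x, |x| ∂F := by
  rw [← integral_const_mul]
  exact norm_integral_le_of_norm_le (hF.abs.const_mul |z|)
    (Eventually.of_forall fun x => norm_exp_I_mul_mul_sub_one_le z x)

lemma continuous_levyExponent {F : Measure ℝ} (hF : Integrable (fun x : ℝ => x) F) :
    Continuous (levyExponent F) := by
  refine continuous_iff_continuousAt.2 fun z₀ => ?_
  refine continuousAt_of_dominated (bound := fun x => (|z₀| + 1) * |x|)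
    (Eventually.of_forall fun z => by fun_prop) ?_ (hF.abs.const_mul _)
    (Eventually.of_forall fun x => by fun_prop)
  have h : ∀ᶠ z : ℝ in 𝓝 z₀, |z| < |z₀| + 1 :=
    continuous_abs.continuousAt.eventually_lt_const (by simp)
  filter_upwards [h] with z hz
  refine Eventually.of_forall fun x => (norm_exp_I_mul_mul_sub_one_le z x).trans ?_
  gcongr

lemma levyExponent_re_nonpos {F : Measure ℝ} (hF : Integrable (fun x : ℝ => x) F) (z : ℝ) :
    (levyExponent F z).re ≤ 0 := by
  have h := integral_re (integrable_exp_I_mul_mul_sub_one hF z)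
  simp only [RCLike.re_to_complex] at h
  rw [levyExponent, ← h]
  refine integral_nonpos fun x => ?_
  have h2 := (Complex.re_le_norm (Complex.exp (Complex.I * (z : ℂ) * (x : ℂ))))
  rw [mul_assoc, ← Complex.ofReal_mul, Complex.norm_exp_I_mul_ofReal] at h2
  simp only [Pi.zero_apply, Complex.sub_re, Complex.one_re, mul_assoc, ← Complex.ofReal_mul]
  linarith

lemma levyExponent_zero (F : Measure ℝ) : levyExponent F 0 = 0 := by simp [levyExponent]

/-- Mean value inequality on the left half-plane, where the derivative of `exp` has norm at most
`1`. -/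
lemma Complex.norm_exp_sub_one_le_of_re_nonpos {w : ℂ} (hw : w.re ≤ 0) :
    ‖Complex.exp w - 1‖ ≤ ‖w‖ := by
  have h := (convex_halfSpace_re_le (0 : ℝ)).norm_image_sub_le_of_norm_deriv_le
    (f := Complex.exp) (C := 1) (fun z _ => Complex.differentiableAt_exp) (fun z hz => by
      rw [Complex.deriv_exp, Complex.norm_exp]
      exact Real.exp_le_one_iff.2 hz) (x := 0) (y := w) (by simp) hw
  simpa using h

lemma norm_two_pow_mul_exp_sub_one_le {w : ℂ} (hw : w.re ≤ 0) (k : ℕ) :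
    ‖(2 : ℂ) ^ k * (Complex.exp (w / 2 ^ k) - 1)‖ ≤ ‖w‖ := by
  have hre : (w / 2 ^ k).re ≤ 0 := by
    have : w / 2 ^ k = ((2 ^ k : ℝ)⁻¹ : ℝ) * w := by push_cast; field_simp
    rw [this, Complex.re_ofReal_mul]
    exact mul_nonpos_of_nonneg_of_nonpos (by positivity) hw
  rw [norm_mul]
  calc _ ≤ ‖(2 : ℂ) ^ k‖ * ‖w / 2 ^ k‖ := by
        gcongr; exact Complex.norm_exp_sub_one_le_of_re_nonpos hre
    _ = ‖w‖ := by rw [← norm_mul]; congr 1; field_simp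

lemma tendsto_two_pow_mul_exp_sub_one (w : ℂ) :
    Tendsto (fun k : ℕ => (2 : ℂ) ^ k * (Complex.exp (w / 2 ^ k) - 1)) atTop (𝓝 w) := by
  have h : HasDerivAt (fun t : ℂ => Complex.exp (t * w)) w 0 := by
    have := ((hasDerivAt_id (0 : ℂ)).mul_const w).cexp
    simpa using this
  have h2 : Tendsto (fun k : ℕ => ((2 : ℂ)⁻¹) ^ k) atTop (𝓝[≠] 0) := by
    refine tendsto_nhdsWithin_iff.2 ⟨tendsto_pow_atTop_nhds_zero_of_norm_lt_one (by norm_num), ?_⟩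
    exact Eventually.of_forall fun k => by simp
  have h3 := (hasDerivAt_iff_tendsto_slope_zero.1 h).comp h2
  refine h3.congr fun k => ?_
  simp [div_eq_inv_mul]

lemma SchwartzMap.apply_eq_integral_fourier (χ : 𝓢(ℝ, ℂ)) (x : ℝ) :
    χ x = ∫ v : ℝ, (𝓕 χ) v * Complex.exp (Complex.I * ((2 * Real.pi * v : ℝ) : ℂ) * (x : ℂ)) := by
  conv_lhs => rw [← FourierTransform.fourierInv_fourier_eq (F := 𝓢(ℝ, ℂ)) χ]
  rw [SchwartzMap.fourierInv_coe, Real.fourierInv_eq']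
  refine integral_congr_ae (Eventually.of_forall fun v => ?_)
  simp only [smul_eq_mul]
  rw [mul_comm]
  congr 2
  simp
  ring

lemma SchwartzMap.integrable_fourier_mul (χ : 𝓢(ℝ, ℂ)) {g : ℝ → ℂ} (hg : Continuous g)
    {C : ℝ} (hC : ∀ v, ‖g v‖ ≤ C) : Integrable (fun v => (𝓕 χ) v * g v) :=
  (𝓕 χ).integrable.mul_bdd hg.aestronglyMeasurable (Eventually.of_forall hC)

lemma SchwartzMap.apply_sub_apply_zero (χ : 𝓢(ℝ, ℂ)) (x : ℝ) :
    χ x - χ 0 = ∫ v : ℝ, (𝓕 χ) v *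
      (Complex.exp (Complex.I * ((2 * Real.pi * v : ℝ) : ℂ) * (x : ℂ)) - 1) := by
  have hint : ∀ x : ℝ, Integrable (fun v : ℝ => (𝓕 χ) v *
      Complex.exp (Complex.I * ((2 * Real.pi * v : ℝ) : ℂ) * (x : ℂ))) := fun x =>
    χ.integrable_fourier_mul (by fun_prop) (C := 1) fun v => by
      rw [mul_assoc, ← Complex.ofReal_mul, Complex.norm_exp_I_mul_ofReal]
  rw [χ.apply_eq_integral_fourier x, χ.apply_eq_integral_fourier 0,
    ← integral_sub (hint x) (hint 0)]
  simp [mul_sub]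

/-- Fubini applied to Fourier inversion. Subtracting `χ 0` makes the integrand `O(|x|)`, hence
integrable even against an infinite measure with finite first moment. -/
lemma SchwartzMap.integral_sub_apply_zero (χ : 𝓢(ℝ, ℂ)) (ν : Measure ℝ) [SFinite ν]
    (hint : Integrable (fun p : ℝ × ℝ => (𝓕 χ) p.1 *
      (Complex.exp (Complex.I * ((2 * Real.pi * p.1 : ℝ) : ℂ) * (p.2 : ℂ)) - 1))
      (volume.prod ν)) :
    ∫ x, (χ x - χ 0) ∂ν = ∫ v : ℝ, (𝓕 χ) v * levyExponent ν (2 * Real.pi * v) := by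
  simp_rw [χ.apply_sub_apply_zero]
  rw [← integral_integral_swap hint]
  simp_rw [integral_const_mul]
  rfl

lemma SchwartzMap.integrable_abs_mul_norm_fourier (χ : 𝓢(ℝ, ℂ)) :
    Integrable (fun v : ℝ => |v| * ‖(𝓕 χ) v‖) := by
  have h := SchwartzMap.integrable_pow_mul volume (𝓕 χ : 𝓢(ℝ, ℂ)) 1
  simpa only [pow_one, Real.norm_eq_abs] using h

lemma SchwartzMap.integral_sub_apply_zero_of_integrable (χ : 𝓢(ℝ, ℂ)) {F : Measure ℝ}
    [SFinite F] (hF : Integrable (fun x : ℝ => x) F) :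
    ∫ x, (χ x - χ 0) ∂F = ∫ v : ℝ, (𝓕 χ) v * levyExponent F (2 * Real.pi * v) := by
  refine χ.integral_sub_apply_zero F ?_
  refine ((χ.integrable_abs_mul_norm_fourier.const_mul (2 * Real.pi)).mul_prod hF.abs).mono'
    ?_ (Eventually.of_forall fun p => ?_)
  · exact (((𝓕 χ).continuous.comp continuous_fst).mul (by fun_prop)).aestronglyMeasurable
  · rw [norm_mul]
    have h := norm_exp_I_mul_mul_sub_one_le (2 * Real.pi * p.1) p.2
    rw [abs_mul, abs_of_pos Real.two_pi_pos] at h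
    calc _ ≤ ‖(𝓕 χ) p.1‖ * (2 * Real.pi * |p.1| * |p.2|) := by gcongr
      _ = _ := by ring

lemma SchwartzMap.integral_sub_apply_zero_of_isProbabilityMeasure (χ : 𝓢(ℝ, ℂ))
    (μ : Measure ℝ) [IsProbabilityMeasure μ] :
    ∫ x, (χ x - χ 0) ∂μ = ∫ v : ℝ, (𝓕 χ) v * (charFun μ (2 * Real.pi * v) - 1) := by
  rw [χ.integral_sub_apply_zero μ]
  · refine integral_congr_ae (Eventually.of_forall fun v => ?_)
    simp only
    congr 1
    rw [levyExponent, integral_sub _ (integrable_const _), charFun_apply_real]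
    · simp only [integral_const, probReal_univ, one_smul]
      congr 1
      refine integral_congr_ae (Eventually.of_forall fun x => ?_)
      simp only
      congr 1
      ring
    · refine Integrable.of_bound (C := 1) (by fun_prop) (Eventually.of_forall fun x => ?_)
      rw [mul_assoc, ← Complex.ofReal_mul, Complex.norm_exp_I_mul_ofReal]
  · refine (((𝓕 χ).integrable.norm.mul_const 2).comp_fst μ).mono'
      (((𝓕 χ).continuous.comp continuous_fst).mul (by fun_prop)).aestronglyMeasurable
      (Eventually.of_forall fun p => ?_)
    rw [norm_mul]
    gcongr
    refine (norm_sub_le _ _).trans ?_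
    rw [mul_assoc, ← Complex.ofReal_mul, Complex.norm_exp_I_mul_ofReal]
    norm_num

/-- Convergence of the rescaled laws of an infinitely divisible family to the Lévy measure, tested
on Schwartz functions. -/
lemma SchwartzMap.tendsto_two_pow_mul_integral (χ : 𝓢(ℝ, ℂ)) {F : Measure ℝ} [SFinite F]
    (hF : Integrable (fun x : ℝ => x) F) (μ : ℕ → Measure ℝ) [∀ k, IsProbabilityMeasure (μ k)]
    (hμ : ∀ k z, charFun (μ k) z = Complex.exp (levyExponent F z / 2 ^ k)) :
    Tendsto (fun k : ℕ => (2 : ℂ) ^ k * ∫ x, (χ x - χ 0) ∂(μ k)) atTop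
      (𝓝 (∫ x, (χ x - χ 0) ∂F)) := by
  rw [χ.integral_sub_apply_zero_of_integrable hF]
  have h : ∀ k : ℕ, (2 : ℂ) ^ k * ∫ x, (χ x - χ 0) ∂(μ k) = ∫ v : ℝ, (𝓕 χ) v *
      (2 ^ k * (Complex.exp (levyExponent F (2 * Real.pi * v) / 2 ^ k) - 1)) := by
    intro k
    rw [χ.integral_sub_apply_zero_of_isProbabilityMeasure, ← integral_const_mul]
    simp_rw [hμ]
    refine integral_congr_ae (Eventually.of_forall fun v => ?_)
    simp only
    ring
  simp_rw [h]
  have hc := continuous_levyExponent hF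
  -- The dominating function is uniform in `k`: the exponent has nonpositive real part and grows at
  -- most linearly, while `𝓕 χ` has a finite first absolute moment.
  refine tendsto_integral_of_dominated_convergence
    (fun v => 2 * Real.pi * (∫ x, |x| ∂F) * (|v| * ‖(𝓕 χ) v‖))
    (fun k => ((𝓕 χ).continuous.mul (by fun_prop)).aestronglyMeasurable)
    (χ.integrable_abs_mul_norm_fourier.const_mul _)
    (fun k => Eventually.of_forall fun v => ?_)
    (Eventually.of_forall fun v => (tendsto_two_pow_mul_exp_sub_one _).const_mul _)
  rw [norm_mul]
  have h1 := norm_two_pow_mul_exp_sub_one_le (levyExponent_re_nonpos hF (2 * Real.pi * v)) k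
  have h2 := norm_levyExponent_le hF (2 * Real.pi * v)
  rw [abs_mul, abs_of_pos Real.two_pi_pos] at h2
  calc _ ≤ ‖(𝓕 χ) v‖ * (2 * Real.pi * |v| * ∫ x, |x| ∂F) := by gcongr; exact h1.trans h2
    _ = _ := by ring

end

/-! ### From test functions to masses of half-lines. -/

section

open scoped FourierTransform SchwartzMap ContDiff

lemma tendsto_two_pow_mul_integral_of_contDiff {f : ℝ → ℝ} (hf : ContDiff ℝ ∞ f)
    (hfc : HasCompactSupport f) {F : Measure ℝ} [SFinite F]
    (hF : Integrable (fun x : ℝ => x) F) (μ : ℕ → Measure ℝ) [∀ k, IsProbabilityMeasure (μ k)]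
    (hμ : ∀ k z, charFun (μ k) z = Complex.exp (levyExponent F z / 2 ^ k)) :
    Tendsto (fun k : ℕ => (2 : ℝ) ^ k * ∫ x, (f x - f 0) ∂(μ k)) atTop
      (𝓝 (∫ x, (f x - f 0) ∂F)) := by
  have hc : HasCompactSupport (fun x => (f x : ℂ)) := hfc.comp_left Complex.ofReal_zero
  let χ : 𝓢(ℝ, ℂ) := hc.toSchwartzMap (Complex.ofRealCLM.contDiff.comp hf)
  have hχ : ∀ x, χ x = (f x : ℂ) := fun _ => rfl
  have h := χ.tendsto_two_pow_mul_integral hF μ hμ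
  simp only [hχ, ← Complex.ofReal_sub, integral_complex_ofReal] at h
  refine ((Complex.continuous_re.tendsto _).comp h).congr fun k => ?_
  simp only [Function.comp_apply]
  norm_cast

lemma eventually_two_pow_mul_measure_Ioi_le {F : Measure ℝ} [SFinite F]
    (hF : Integrable (fun x : ℝ => x) F) (hpos : ∀ᵐ x ∂F, 0 < x) (μ : ℕ → Measure ℝ)
    [∀ k, IsProbabilityMeasure (μ k)]
    (hμ : ∀ k z, charFun (μ k) z = Complex.exp (levyExponent F z / 2 ^ k))
    {ε' ε : ℝ} (hε' : 0 < ε') (hε : ε' < ε) :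
    ∀ᶠ k : ℕ in atTop, 2 ^ k * (μ k).real (Set.Ioi ε) ≤ F.real (Set.Ioi ε') + 1 := by
  -- `1 - f` vanishes on `[-ε', ε']` and equals `1` beyond `ε`, so it separates the two indicators
  -- on the positive axis, which carries `F`. The `+ 1` in the statement is slack for passing from
  -- the limit to large `k`.
  let f : ContDiffBump (0 : ℝ) := ⟨ε', ε, hε', hε⟩
  have h0 : f 0 = 1 := f.one_of_mem_closedBall (by simp [hε'.le, f])
  have h := (tendsto_two_pow_mul_integral_of_contDiff f.contDiff f.hasCompactSupport hF μ hμ).neg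
  have hlim : -∫ x, (f x - f 0) ∂F < F.real (Set.Ioi ε') + 1 := by
    rw [← integral_neg, ← integral_indicator_one measurableSet_Ioi]
    refine (integral_mono_of_nonneg (Eventually.of_forall fun x => ?_)
      ((integrable_indicator_iff measurableSet_Ioi).2
        (integrableOn_const (hF.measure_gt_lt_top hε').ne)) ?_).trans_lt (lt_add_one _)
    · simp [h0, f.le_one]
    · filter_upwards [hpos] with x hx
      by_cases hx' : ε' < x
      · simp [hx', h0, f.nonneg]
      · rw [f.one_of_mem_closedBall (by
          simpa [abs_of_pos hx, f] using le_of_not_gt hx')]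
        simp [hx', h0]
  filter_upwards [h.eventually_lt_const hlim] with k hk
  refine le_trans ?_ hk.le
  rw [← mul_neg, ← integral_neg, ← integral_indicator_one measurableSet_Ioi]
  refine mul_le_mul_of_nonneg_left ?_ (by positivity)
  refine integral_mono_of_nonneg (Eventually.of_forall fun x =>
      Set.indicator_nonneg (fun _ _ => zero_le_one) x) ?_ (Eventually.of_forall fun x => ?_)
  · refine Integrable.of_bound (C := 1) ?_ (Eventually.of_forall fun x => ?_)
    · exact (f.continuous.sub continuous_const).neg.aestronglyMeasurable
    · rw [h0, Real.norm_eq_abs, abs_le]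
      constructor <;> linarith [f.nonneg (x := x), f.le_one (x := x)]
  · by_cases hx : ε < x
    · have hfx : f x = 0 := f.zero_of_le_dist (by
        rw [Real.dist_eq, sub_zero]; exact hx.le.trans (le_abs_self x))
      simp [hx, h0, hfx]
    · simp [hx, h0, f.le_one]

lemma eventually_le_two_pow_mul_measure_Ioi {F : Measure ℝ} [SFinite F]
    (hF : Integrable (fun x : ℝ => x) F) (μ : ℕ → Measure ℝ)
    [∀ k, IsProbabilityMeasure (μ k)]
    (hμ : ∀ k z, charFun (μ k) z = Complex.exp (levyExponent F z / 2 ^ k))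
    {ε a b : ℝ} (hε : 0 < ε) (ha : ε < a) (hab : a < b) :
    ∀ᶠ k : ℕ in atTop, F.real (Set.Icc a b) - 1 ≤ 2 ^ k * (μ k).real (Set.Ioi ε) := by
  -- The inner ball is `[a, b]`; the outer radius is chosen so that the support starts exactly at
  -- `ε`. Compact support is why `F` is tested on a bounded interval.
  let f : ContDiffBump ((a + b) / 2 : ℝ) :=
    ⟨(b - a) / 2, (b - a) / 2 + (a - ε), by linarith, by linarith⟩
  have hle : ∀ x ≤ ε, f x = 0 := fun x hx => f.zero_of_le_dist (by
    rw [dist_comm, Real.dist_eq]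
    refine le_trans ?_ (le_abs_self _)
    simp only [f]
    linarith)
  have h0 : f 0 = 0 := hle 0 hε.le
  have hupper : ∀ x, f x ≤ (Set.Ioi ε).indicator 1 x := fun x => by
    by_cases hx : ε < x
    · simp [hx, f.le_one]
    · simp [hx, hle x (le_of_not_gt hx)]
  have hint : ∀ ν : Measure ℝ, ν (Set.Ioi ε) < ⊤ → Integrable (fun x => (Set.Ioi ε).indicator
      (1 : ℝ → ℝ) x) ν := fun ν hν =>
    (integrable_indicator_iff measurableSet_Ioi).2 (integrableOn_const hν.ne)
  have hfin := hF.measure_gt_lt_top hε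
  have hfint : Integrable f F := (hint F hfin).mono' f.continuous.aestronglyMeasurable
    (Eventually.of_forall fun x => by
      rw [Real.norm_eq_abs, abs_of_nonneg f.nonneg]; exact hupper x)
  have h := tendsto_two_pow_mul_integral_of_contDiff f.contDiff f.hasCompactSupport hF μ hμ
  have hlim : F.real (Set.Icc a b) - 1 < ∫ x, (f x - f 0) ∂F := by
    refine (sub_one_lt _).trans_le ?_
    rw [← integral_indicator_one measurableSet_Icc]
    simp only [h0, sub_zero]
    refine integral_mono_of_nonneg (Eventually.of_forall fun x =>
      Set.indicator_nonneg (fun _ _ => zero_le_one) x) hfint (Eventually.of_forall fun x => ?_)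
    by_cases hx : x ∈ Set.Icc a b
    · rw [f.one_of_mem_closedBall (by
        rw [Metric.mem_closedBall, Real.dist_eq, abs_le]
        simp only [f]
        constructor <;> linarith [hx.1, hx.2])]
      simp [hx]
    · rw [Set.indicator_of_notMem hx]
      exact f.nonneg
  filter_upwards [h.eventually_const_lt hlim] with k hk
  refine hk.le.trans ?_
  rw [← integral_indicator_one measurableSet_Ioi]
  refine mul_le_mul_of_nonneg_left ?_ (by positivity)
  simp only [h0, sub_zero]
  exact integral_mono_of_nonneg (Eventually.of_forall fun x => f.nonneg)
    (hint _ (measure_lt_top _ _)) (Eventually.of_forall hupper)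

end

/-! ### Tails of the tempered stable Lévy measure. -/

section

variable {α β lam : ℝ}

instance sFinite_tsLevyMeasure : SFinite (tsLevyMeasure α β lam) := by
  unfold tsLevyMeasure; infer_instance

lemma ae_pos_tsLevyMeasure : ∀ᵐ x ∂(tsLevyMeasure α β lam), 0 < x :=
  (withDensity_absolutelyContinuous _ _).ae_le (ae_restrict_mem measurableSet_Ioi)

lemma integrable_id_tsLevyMeasure (hα : 0 < α) (hlam : 0 < lam) (hβ1 : β < 1) :
    Integrable (fun x : ℝ => x) (tsLevyMeasure α β lam) := by
  rw [tsLevyMeasure, integrable_withDensity_iff_integrable_smul' (by fun_prop)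
    (Eventually.of_forall fun x => ENNReal.ofReal_lt_top)]
  have h := (integrableOn_rpow_mul_exp_neg_mul_rpow (s := -β) (p := 1) (by linarith) one_pos
    hlam).const_mul α
  refine Integrable.congr h ?_
  filter_upwards [ae_restrict_mem measurableSet_Ioi] with x hx
  have hx : 0 < x := hx
  rw [ENNReal.toReal_ofReal (by positivity), Real.rpow_one, Real.rpow_add hx, Real.rpow_one,
    Real.rpow_neg hx.le, smul_eq_mul]
  field_simp

lemma tsLevyMeasure_real_apply (hα : 0 < α) {s : Set ℝ} (hs : MeasurableSet s)
    (hs0 : s ⊆ Set.Ioi 0) : (tsLevyMeasure α β lam).real s =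
      ∫ x in s, α / x ^ (1 + β) * Real.exp (-lam * x) := by
  rw [Measure.real, tsLevyMeasure, withDensity_apply _ hs,
    Measure.restrict_restrict hs, Set.inter_eq_left.2 hs0, integral_eq_lintegral_of_nonneg_ae]
  · filter_upwards [ae_restrict_mem hs] with x hx
    have hx : 0 < x := hs0 hx
    simp only [Pi.zero_apply]
    positivity
  · exact (by fun_prop : Measurable fun x : ℝ =>
      α / x ^ (1 + β) * Real.exp (-lam * x)).aestronglyMeasurable

lemma tsLevyMeasure_real_Ioi_le (hα : 0 < α) (hlam : 0 < lam) (hβ0 : 0 < β) {a : ℝ}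
    (ha : 0 < a) : (tsLevyMeasure α β lam).real (Set.Ioi a) ≤ α / β * a ^ (-β) := by
  rw [tsLevyMeasure_real_apply hα measurableSet_Ioi (Set.Ioi_subset_Ioi ha.le)]
  have hint := integrableOn_Ioi_rpow_of_lt (a := -(1 + β)) (by linarith) ha
  calc _ ≤ ∫ x in Set.Ioi a, α * x ^ (-(1 + β)) := by
        refine integral_mono_of_nonneg ?_ (hint.const_mul α) ?_ <;>
          filter_upwards [ae_restrict_mem measurableSet_Ioi] with x hx <;>
          have hx : 0 < x := ha.trans hx
        · simp only [Pi.zero_apply]; positivity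
        · rw [Real.rpow_neg hx.le, ← div_eq_mul_inv]
          refine mul_le_of_le_one_right (by positivity) (Real.exp_le_one_iff.2 ?_)
          nlinarith
    _ = _ := by
        rw [integral_const_mul, integral_Ioi_rpow_of_lt (by linarith) ha]
        rw [show -(1 + β) + 1 = -β by ring]
        field_simp

/-- Since `e^(-λx) ≥ 1 - λx`, tempering costs at most `αλ ∫ x^(-β)` over `(0,1]`, which is finite
because `β < 1`. -/
lemma le_tsLevyMeasure_real_Icc (hα : 0 < α) (hlam : 0 < lam) (hβ0 : 0 < β) (hβ1 : β < 1)
    {a : ℝ} (ha : 0 < a) (ha1 : a ≤ 1) :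
    α / β * (a ^ (-β) - 1) - α * lam / (1 - β) ≤ (tsLevyMeasure α β lam).real (Set.Icc a 1) := by
  have hsub : Set.Icc a 1 ⊆ Set.Ioi 0 := fun x hx => ha.trans_le hx.1
  rw [tsLevyMeasure_real_apply hα measurableSet_Icc hsub, integral_Icc_eq_integral_Ioc,
    ← intervalIntegral.integral_of_le ha1]
  have h0 : (0 : ℝ) ∉ Set.uIcc a 1 := by
    rw [Set.uIcc_of_le ha1]; exact fun h => ha.not_ge h.1
  have h1 : IntervalIntegrable (fun x : ℝ => α * x ^ (-(1 + β))) volume a 1 :=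
    (intervalIntegral.intervalIntegrable_rpow (Or.inr h0)).const_mul α
  have h2 : IntervalIntegrable (fun x : ℝ => α * lam * x ^ (-β)) volume a 1 :=
    (intervalIntegral.intervalIntegrable_rpow (Or.inr h0)).const_mul _
  have h3 : IntervalIntegrable (fun x : ℝ => α / x ^ (1 + β) * Real.exp (-lam * x)) volume a 1 := by
    refine ContinuousOn.intervalIntegrable ?_
    rw [Set.uIcc_of_le ha1]
    intro x hx
    have hx : 0 < x := hsub hx
    refine ContinuousAt.continuousWithinAt ?_
    have : x ^ (1 + β) ≠ 0 := by positivity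
    have hc := Real.continuousAt_rpow_const x (1 + β) (Or.inl hx.ne')
    exact (continuousAt_const.div hc this).mul (by fun_prop)
  have hval : ∫ x in a..1, (α * x ^ (-(1 + β)) - α * lam * x ^ (-β)) =
      α / β * (a ^ (-β) - 1) - α * lam * ((1 - a ^ (1 - β)) / (1 - β)) := by
    rw [intervalIntegral.integral_sub h1 h2, intervalIntegral.integral_const_mul,
      intervalIntegral.integral_const_mul, integral_rpow (Or.inr ⟨by linarith, h0⟩),
      integral_rpow (Or.inl (by linarith)), show -(1 + β) + 1 = -β by ring,
      show -β + 1 = 1 - β by ring]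
    simp only [Real.one_rpow]
    field_simp
    ring
  have hle : α / β * (a ^ (-β) - 1) - α * lam / (1 - β) ≤
      ∫ x in a..1, (α * x ^ (-(1 + β)) - α * lam * x ^ (-β)) := by
    rw [hval, ← mul_div_assoc]
    have : 0 < 1 - β := by linarith
    have h4 : 0 ≤ a ^ (1 - β) := by positivity
    have h5 : α * lam * (1 - a ^ (1 - β)) ≤ α * lam :=
      mul_le_of_le_one_right (by positivity) (by linarith)
    linarith [div_le_div_of_nonneg_right h5 this.le]
  refine hle.trans (intervalIntegral.integral_mono_on ha1 (h1.sub h2) h3 fun x hx => ?_)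
  have hx : 0 < x := hsub hx
  have h5 : α * x ^ (-(1 + β)) - α * lam * x ^ (-β) = α / x ^ (1 + β) * (-lam * x + 1) := by
    rw [Real.rpow_neg hx.le, Real.rpow_neg hx.le, Real.rpow_add hx, Real.rpow_one]
    field_simp
    ring
  rw [h5]
  gcongr
  exact Real.add_one_le_exp _

end

/-! ### Characteristic functions at dyadic times. -/

section

variable {Ω : Type*} [MeasurableSpace Ω] {P : Measure Ω} {X : ℝ≥0 → Ω → ℝ}

lemma dyadicTime_succ_two (k : ℕ) : dyadicTime (k + 1) 2 = dyadicTime k 1 := by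
  simp only [dyadicTime, pow_succ]
  push_cast
  field_simp

lemma IsLevyProcess.charFun_dyadic_sq [IsProbabilityMeasure P] (hX : IsLevyProcess P X) (k : ℕ) :
    charFun (P.map (X (dyadicTime k 1))) = charFun (P.map (X (dyadicTime (k + 1) 1))) ^ 2 := by
  have h01 : dyadicTime (k + 1) 1 ≤ dyadicTime (k + 1) 2 := dyadicTime_mono _ (by norm_num)
  have hind := hX.indep_increments.indepFun_eval_sub zero_le h01 hX.start_zero
  have h := hind.charFun_map_add_eq_mul (hX.measurable _).aemeasurable
    ((hX.measurable _).sub (hX.measurable _)).aemeasurable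
  rw [add_sub_cancel, dyadicTime_succ_two] at h
  rw [h, sq]
  congr 2
  rw [← dyadicTime_succ_two]
  exact hX.map_dyadic_increment (k + 1) 1

/-- Halving the time takes a square root of the characteristic function. Two continuous roots on the
connected line agree up to a global sign, and the value `1` at `0` fixes it. -/
lemma IsLevyProcess.charFun_dyadic [IsProbabilityMeasure P] (hX : IsLevyProcess P X)
    {F : Measure ℝ} (hF : Integrable (fun x : ℝ => x) F)
    (h1 : ∀ z, charFun (P.map (X 1)) z = Complex.exp (levyExponent F z)) (k : ℕ) (z : ℝ) :
    charFun (P.map (X (dyadicTime k 1))) z = Complex.exp (levyExponent F z / 2 ^ k) := by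
  induction k generalizing z with
  | zero => simpa [dyadicTime] using h1 z
  | succ k ih =>
    have : IsProbabilityMeasure (P.map (X (dyadicTime (k + 1) 1))) :=
      Measure.isProbabilityMeasure_map (hX.measurable _).aemeasurable
    have hc := continuous_levyExponent hF
    have hsq : Set.EqOn (charFun (P.map (X (dyadicTime (k + 1) 1))) ^ 2)
        ((fun z => Complex.exp (levyExponent F z / 2 ^ (k + 1))) ^ 2) Set.univ := by
      intro z _
      rw [← hX.charFun_dyadic_sq, ih, Pi.pow_apply, ← Complex.exp_nat_mul]
      congr 1
      field_simp
      ring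
    rcases isPreconnected_univ.eq_or_eq_neg_of_sq_eq continuous_charFun.continuousOn
      (by fun_prop) hsq (fun _ => Complex.exp_ne_zero _) with h | h
    · exact h (Set.mem_univ z)
    · have h0 := h (Set.mem_univ 0)
      simp [levyExponent_zero] at h0
      norm_num [Complex.ext_iff] at h0

end

/-! ### The levels `φ_β(n)`. -/

section

variable {β : ℝ}

lemma phiLevel_pos (hβ : 0 < β) (n : ℕ) : 0 < phiLevel β n := by
  unfold phiLevel; positivity

lemma phiLevel_zero : phiLevel β 0 = 1 := by simp [phiLevel]

lemma phiLevel_lt (hβ : 0 < β) {m n : ℕ} (h : m < n) : phiLevel β n < phiLevel β m := by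
  have h' : (m : ℝ) < n := by exact_mod_cast h
  exact Real.rpow_lt_rpow_of_neg (by positivity) (by gcongr) (by simpa using hβ)

lemma phiLevel_rpow_neg (hβ : 0 < β) (n : ℕ) : phiLevel β n ^ (-β) = 1 + β * n := by
  rw [phiLevel, ← Real.rpow_mul (by positivity)]
  field_simp
  simp

end

/-! ### Borel–Cantelli for events holding at all fine scales. -/

section

variable {Ω : Type*} [MeasurableSpace Ω] {P : Measure Ω}

/-- The event is an increasing union of the sets `⋂ k ≥ N, A k`, each contained in some `A k`
satisfying the bound. -/
lemma measure_setOf_eventually_le {A : ℕ → Set Ω} {b : ℝ≥0∞} (h : ∀ᶠ k in atTop, P (A k) ≤ b) :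
    P {ω | ∀ᶠ k in atTop, ω ∈ A k} ≤ b := by
  have hU : {ω | ∀ᶠ k in atTop, ω ∈ A k} = ⋃ N, ⋂ k ≥ N, A k := by
    ext ω; simp [eventually_atTop]
  have hmono : Monotone fun N => ⋂ k ≥ N, A k := fun M N hMN =>
    Set.biInter_subset_biInter_left fun k (hk : N ≤ k) => hMN.trans hk
  rw [hU, hmono.measure_iUnion]
  refine iSup_le fun N => ?_
  obtain ⟨k, hk, hkN⟩ := (h.and (eventually_ge_atTop N)).exists
  exact (measure_mono (Set.biInter_subset_of_mem hkN)).trans hk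

lemma ae_eventually_not_eventually [IsFiniteMeasure P] {A : ℕ → ℕ → Set Ω} {K c : ℝ} (hc : 0 < c)
    (h : ∀ n ≥ 2, ∀ᶠ k in atTop, P.real (A n k) ≤ Real.exp (K - c * n)) :
    ∀ᵐ ω ∂P, ∀ᶠ n in atTop, ¬ ∀ᶠ k in atTop, ω ∈ A n k := by
  have hsum : Summable fun n : ℕ => Real.exp (K - c * (n + 2 : ℕ)) := by
    have h1 := (Real.summable_exp_nat_mul_iff.2 (neg_neg_of_pos hc)).mul_left
      (Real.exp (K - c * 2))
    refine h1.congr fun n => ?_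
    rw [← Real.exp_add]
    congr 1
    push_cast
    ring
  have hbc : ∀ᵐ ω ∂P, ∀ᶠ n in atTop, ω ∉ {ω | ∀ᶠ k in atTop, ω ∈ A (n + 2) k} := by
    refine ae_eventually_notMem (ne_top_of_le_ne_top hsum.tsum_ofReal_ne_top
      (ENNReal.tsum_le_tsum fun n => measure_setOf_eventually_le ?_))
    filter_upwards [h (n + 2) (by omega)] with k hk
    rw [← ofReal_measureReal]
    exact ENNReal.ofReal_le_ofReal hk
  filter_upwards [hbc] with ω hω
  obtain ⟨N, hN⟩ := eventually_atTop.1 hω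
  refine eventually_atTop.2 ⟨N + 2, fun n hn => ?_⟩
  obtain ⟨m, rfl⟩ := Nat.exists_eq_add_of_le' (show 2 ≤ n by omega)
  exact hN m (by omega)

end

/-! ### Chernoff exponents. -/

section

/-- With `t = η / 2` and `e^t - 1 ≤ t + t^2`, the coefficient of `x` becomes `-η^2 / 4`; the mean's
error `C` contributes only a bounded term. -/
lemma chernoff_exponent_upper {η x C : ℝ} (hη : 0 < η) (hη1 : η ≤ 1) (hx : 0 ≤ x) (hC : 0 ≤ C) :
    -(η / 2) * ((1 + η) * x) + (x + C) * (Real.exp (η / 2) - 1) ≤ 2 * C - η ^ 2 / 4 * x := by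
  have h := (abs_le.1 (Real.abs_exp_sub_one_sub_id_le (x := η / 2)
    (by rw [abs_of_pos (by linarith)]; linarith))).2
  have h1 : Real.exp (η / 2) - 1 ≤ η / 2 + (η / 2) ^ 2 := by linarith
  have h2 := mul_le_mul_of_nonneg_left h1 (add_nonneg hx hC)
  have h3 : C * (η / 2 + (η / 2) ^ 2) ≤ C * 2 := by gcongr; nlinarith
  nlinarith

lemma chernoff_exponent_lower {η x C : ℝ} (hη : 0 < η) (hη1 : η ≤ 1) (hx : 0 ≤ x) (hC : 0 ≤ C) :
    η / 2 * ((1 - η) * x) + (x - C) * (Real.exp (-(η / 2)) - 1) ≤ 2 * C - η ^ 2 / 4 * x := by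
  have h := (abs_le.1 (Real.abs_exp_sub_one_sub_id_le (x := -(η / 2))
    (by rw [abs_neg, abs_of_pos (by linarith)]; linarith))).2
  have h1 : Real.exp (-(η / 2)) - 1 ≤ -(η / 2) + (η / 2) ^ 2 := by linarith
  have h2 := mul_le_mul_of_nonneg_left h1 hx
  have h3 : -(η / 2) ≤ Real.exp (-(η / 2)) - 1 := by linarith [Real.add_one_le_exp (-(η / 2))]
  have h4 := mul_le_mul_of_nonneg_left h3 hC
  have h5 : C * (η / 2) ≤ C * 2 := by gcongr; linarith
  nlinarith

end

/-! ### Almost sure linear growth of the number of large jumps. -/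

section

variable {Ω : Type*} [MeasurableSpace Ω] {P : Measure Ω} {X : ℝ≥0 → Ω → ℝ} {α β lam : ℝ}

/-- A constant dominating the error of the linear approximation `α n` of the jump intensity above
the level `φ_β(n)`. -/
noncomputable def intensityError (α β lam : ℝ) : ℝ := α + α / β + 1 + α * lam / (1 - β)

lemma IsTemperedStableSubordinator.eventually_intensity [IsProbabilityMeasure P]
    (hX : IsTemperedStableSubordinator P X α β lam) (hα : 0 < α) (hlam : 0 < lam) (hβ0 : 0 < β)
    (hβ1 : β < 1) {n : ℕ} (hn : 2 ≤ n) :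
    ∀ᶠ k in atTop,
      2 ^ k * (P.map (X (dyadicTime k 1))).real (Set.Ioi (phiLevel β n)) ≤
        α * n + intensityError α β lam ∧
      α * n - intensityError α β lam ≤
        2 ^ k * (P.map (X (dyadicTime k 1))).real (Set.Ioi (phiLevel β n)) := by
  have hF := integrable_id_tsLevyMeasure hα hlam hβ1
  have hprob : ∀ k, IsProbabilityMeasure (P.map (X (dyadicTime k 1))) := fun k =>
    Measure.isProbabilityMeasure_map (hX.isLevyProcess.measurable _).aemeasurable
  have hμ := hX.isLevyProcess.charFun_dyadic hF hX.law_one.charFun_eq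
  have hnn : phiLevel β (n + 1 : ℕ) < phiLevel β n := phiLevel_lt hβ0 (Nat.lt_succ_self n)
  obtain ⟨m, rfl⟩ := Nat.exists_eq_add_of_le' (show 1 ≤ n by omega)
  have hm : phiLevel β (m + 1 : ℕ) < phiLevel β m := phiLevel_lt hβ0 (Nat.lt_succ_self m)
  have hm1 : phiLevel β m < 1 := by
    have := phiLevel_lt hβ0 (show 0 < m by omega)
    rwa [Nat.cast_zero, phiLevel_zero] at this
  have hβ2 : 0 < 1 - β := by linarith
  have h1 : 0 < α / β := by positivity
  have h2 : 0 < α * lam / (1 - β) := by positivity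
  -- The upper bound compares with level `n + 1`, the lower one with `[φ_β(n-1), 1]`. Each shift
  -- changes the mass by `O(1)`, and `n ≥ 2` ensures `φ_β(n-1) < 1`.
  filter_upwards [eventually_two_pow_mul_measure_Ioi_le hF ae_pos_tsLevyMeasure _ hμ
      (phiLevel_pos hβ0 _) hnn, eventually_le_two_pow_mul_measure_Ioi hF _ hμ
      (phiLevel_pos hβ0 _) hm hm1] with k hk1 hk2
  have hup := tsLevyMeasure_real_Ioi_le hα hlam hβ0 (phiLevel_pos hβ0 (m + 1 + 1))
  have hlow := le_tsLevyMeasure_real_Icc hα hlam hβ0 hβ1 (phiLevel_pos hβ0 m) hm1.le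
  rw [phiLevel_rpow_neg hβ0] at hup hlow
  have e1 : α / β * (1 + β * (m + 1 + 1 : ℕ)) = α / β + α * (m + 1 + 1) := by
    push_cast; field_simp
  have e2 : α / β * (1 + β * (m : ℝ) - 1) = α * m := by field_simp; ring
  rw [e1] at hup
  rw [e2] at hlow
  unfold intensityError
  push_cast at *
  constructor <;> linarith

lemma intensityError_nonneg (hα : 0 < α) (hlam : 0 < lam) (hβ0 : 0 < β) (hβ1 : β < 1) :
    0 ≤ intensityError α β lam := by
  have hβ2 : 0 < 1 - β := by linarith
  unfold intensityError
  positivity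

/-- Quantifying over finite sets of jump times avoids presupposing that there are finitely many;
finiteness is deduced from this bound. -/
lemma IsTemperedStableSubordinator.ae_eventually_card_lt [IsProbabilityMeasure P]
    (hX : IsTemperedStableSubordinator P X α β lam) (hα : 0 < α) (hlam : 0 < lam) (hβ0 : 0 < β)
    (hβ1 : β < 1) {η : ℝ} (hη : 0 < η) (hη1 : η ≤ 1) :
    ∀ᵐ ω ∂P, ∀ᶠ n : ℕ in atTop, ∀ T : Finset ℝ≥0,
      ↑T ⊆ largeJumpTimes (fun t => X t ω) (phiLevel β n) → (T.card : ℝ) < (1 + η) * (α * n) := by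
  have h := ae_eventually_not_eventually (P := P) (c := η ^ 2 / 4 * α) (by positivity)
    (K := 2 * intensityError α β lam)
    (A := fun n k => {ω | (1 + η) * (α * n) ≤
      ((dyadicExceedances (fun s => X s ω) (phiLevel β n) k).card : ℝ)}) fun n hn => by
    filter_upwards [hX.eventually_intensity hα hlam hβ0 hβ1 hn] with k hk
    refine (hX.isLevyProcess.chernoff_upper (t := η / 2) (by linarith) _ hk.1).trans ?_
    rw [Real.exp_le_exp, mul_assoc]
    exact chernoff_exponent_upper hη hη1 (by positivity)
      (intensityError_nonneg hα hlam hβ0 hβ1)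
  filter_upwards [h, hX.isLevyProcess.cadlag] with ω hω hc
  filter_upwards [hω] with n hn T hT
  by_contra! hcon
  refine hn ?_
  filter_upwards [hc.eventually_card_le hT] with k hk
  exact hcon.trans (by exact_mod_cast hk)

/-- Exceedances of `φ_β(n)` are controlled by jumps above the lower level `φ_β(n+1)`, hence the
index shift. Finiteness is assumed because `ncard` is `0` on infinite sets. -/
lemma IsTemperedStableSubordinator.ae_eventually_lt_ncard [IsProbabilityMeasure P]
    (hX : IsTemperedStableSubordinator P X α β lam) (hα : 0 < α) (hlam : 0 < lam) (hβ0 : 0 < β)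
    (hβ1 : β < 1) {η : ℝ} (hη : 0 < η) (hη1 : η ≤ 1) :
    ∀ᵐ ω ∂P, ∀ᶠ n : ℕ in atTop,
      (largeJumpTimes (fun t => X t ω) (phiLevel β (n + 1 : ℕ))).Finite →
      (1 - η) * (α * n) <
        ((largeJumpTimes (fun t => X t ω) (phiLevel β (n + 1 : ℕ))).ncard : ℝ) := by
  have h := ae_eventually_not_eventually (P := P) (c := η ^ 2 / 4 * α) (by positivity)
    (K := 2 * intensityError α β lam)
    (A := fun n k => {ω | ((dyadicExceedances (fun s => X s ω) (phiLevel β n) k).card : ℝ) ≤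
      (1 - η) * (α * n)}) fun n hn => by
    filter_upwards [hX.eventually_intensity hα hlam hβ0 hβ1 hn] with k hk
    refine (hX.isLevyProcess.chernoff_lower (t := η / 2) (by linarith) _ hk.2).trans ?_
    rw [Real.exp_le_exp, mul_assoc]
    exact chernoff_exponent_lower hη hη1 (by positivity)
      (intensityError_nonneg hα hlam hβ0 hβ1)
  filter_upwards [h, hX.isLevyProcess.cadlag] with ω hω hc
  filter_upwards [hω] with n hn hfin
  by_contra! hcon
  refine hn ?_
  filter_upwards [hc.eventually_le_encard (phiLevel_pos hβ0 (n + 1)).le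
    (phiLevel_lt hβ0 (Nat.lt_succ_self n))] with k hk
  rw [← hfin.cast_ncard_eq] at hk
  refine le_trans ?_ hcon
  exact_mod_cast hk

end

/-! ### Telescoping and conclusion. -/

section

lemma Set.finite_and_ncard_lt_of_forall_finset {γ : Type*} {s : Set γ} {b : ℝ}
    (h : ∀ T : Finset γ, ↑T ⊆ s → (T.card : ℝ) < b) : s.Finite ∧ (s.ncard : ℝ) < b := by
  have hfin : s.Finite := by
    by_contra hinf
    obtain ⟨m, hm⟩ := exists_nat_ge b
    obtain ⟨T, hT, hcard⟩ := Set.Infinite.exists_subset_card_eq hinf m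
    have := h T hT
    rw [hcard] at this
    linarith
  refine ⟨hfin, ?_⟩
  rw [Set.ncard_eq_toFinset_card s hfin]
  exact h _ (by simp)

lemma largeJumpTimes_anti (x : ℝ≥0 → ℝ) {ε ε' : ℝ} (h : ε' ≤ ε) :
    largeJumpTimes x ε ⊆ largeJumpTimes x ε' := fun _ hs => ⟨hs.1, h.trans_lt hs.2⟩

lemma encard_largeJumpTimes_phiLevel_succ {Ω : Type*} {β : ℝ} (hβ : 0 < β) (X : ℝ≥0 → Ω → ℝ)
    (ω : Ω) (n : ℕ) :
    ((largeJumpTimes (fun t => X t ω) (phiLevel β (n + 1 : ℕ))).encard : ℝ≥0∞) =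
      jumpCount X β n ω + (largeJumpTimes (fun t => X t ω) (phiLevel β n)).encard := by
  have hlt : phiLevel β (n + 1 : ℕ) ≤ phiLevel β n := (phiLevel_lt hβ (Nat.lt_succ_self n)).le
  rw [← jumpMeasure_prod_Ioi _ (phiLevel_pos hβ _).le, ← jumpMeasure_prod_Ioi _
    (phiLevel_pos hβ _).le, jumpCount, ← Nat.cast_succ, ← measure_union _
    (measurableSet_Ioc.prod measurableSet_Ioi), ← Set.prod_union, Set.Ioc_union_Ioi_eq_Ioi hlt]
  refine Set.Disjoint.set_prod_right ?_ _ _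
  exact Set.disjoint_left.2 fun x hx hx' => hx.2.not_gt hx'

lemma sum_jumpCount_toReal {Ω : Type*} {β : ℝ} (hβ : 0 < β) (X : ℝ≥0 → Ω → ℝ) (ω : Ω)
    (hfin : ∀ n : ℕ, (largeJumpTimes (fun t => X t ω) (phiLevel β n)).Finite) :
    (∀ n, jumpCount X β n ω ≠ ∞) ∧
    ∀ n : ℕ, ∑ j ∈ Finset.Icc 1 n, (jumpCount X β j ω).toReal =
      ((largeJumpTimes (fun t => X t ω) (phiLevel β (n + 1 : ℕ))).ncard : ℝ) -
        (largeJumpTimes (fun t => X t ω) (phiLevel β (1 : ℕ))).ncard := by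
  have hstep : ∀ n : ℕ,
      ((largeJumpTimes (fun t => X t ω) (phiLevel β (n + 1 : ℕ))).ncard : ℝ≥0∞) =
      jumpCount X β n ω + (largeJumpTimes (fun t => X t ω) (phiLevel β n)).ncard := by
    intro n
    have h := encard_largeJumpTimes_phiLevel_succ hβ X ω n
    rw [← (hfin n).cast_ncard_eq, ← (hfin (n + 1)).cast_ncard_eq] at h
    simpa using h
  have hne : ∀ n, jumpCount X β n ω ≠ ∞ := fun n =>
    ne_top_of_le_ne_top (ENNReal.natCast_ne_top _) (le_self_add.trans (hstep n).ge)
  refine ⟨hne, fun n => ?_⟩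
  induction n with
  | zero => simp
  | succ n ih =>
    rw [Finset.sum_Icc_succ_top (by omega), ih]
    have h := congrArg ENNReal.toReal (hstep (n + 1))
    rw [ENNReal.toReal_add (hne _) (ENNReal.natCast_ne_top _), ENNReal.toReal_natCast,
      ENNReal.toReal_natCast] at h
    linarith

lemma tendsto_div_of_eventually_linear_bounds {α : ℝ} (hα : 0 < α) {N : ℕ → ℝ}
    (hup : ∀ q : ℕ, ∀ᶠ n : ℕ in atTop, N n < (1 + 1 / ((q : ℝ) + 1)) * (α * n))
    (hlow : ∀ q : ℕ, ∀ᶠ n : ℕ in atTop, (1 - 1 / ((q : ℝ) + 1)) * (α * n) < N (n + 1)) (c : ℝ) :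
    Tendsto (fun n : ℕ => 1 / (n : ℝ) * (N (n + 1) - c)) atTop (𝓝 α) := by
  have hmain : Tendsto (fun n : ℕ => N (n + 1) / n) atTop (𝓝 α) := by
    refine Metric.tendsto_atTop'.2 fun e he => ?_
    -- Half of `e` pays for the relative error `1 / (q + 1)`, the other half for the shift from `n`
    -- to `n + 1`, which costs at most `2 * α`.
    obtain ⟨q, hq⟩ := exists_nat_one_div_lt (show 0 < e / (2 * α) by positivity)
    have hq' : 1 / ((q : ℝ) + 1) * α < e / 2 := by
      rw [lt_div_iff₀ (by positivity)] at hq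
      linarith
    have hq0 : 0 < 1 / ((q : ℝ) + 1) := by positivity
    have hq1 : 1 / ((q : ℝ) + 1) ≤ 1 := by
      rw [div_le_one (by positivity)]
      linarith [(Nat.cast_nonneg q : (0 : ℝ) ≤ q)]
    have hbig : ∀ᶠ n : ℕ in atTop, 2 * α < e / 2 * n :=
      (tendsto_natCast_atTop_atTop.const_mul_atTop (half_pos he)).eventually_gt_atTop _
    have hev := ((tendsto_add_atTop_nat 1).eventually (hup q)).and
      ((hlow q).and (hbig.and (eventually_gt_atTop 0)))
    obtain ⟨n₀, h₀⟩ := eventually_atTop.1 hev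
    refine ⟨n₀, fun n hn => ?_⟩
    obtain ⟨h1, h2, h3, h4⟩ := h₀ n hn.le
    have hn0 : (0 : ℝ) < n := by exact_mod_cast h4
    generalize 1 / ((q : ℝ) + 1) = η at *
    push_cast at h1
    have h5 := mul_lt_mul_of_pos_right hq' hn0
    have h6 : (1 + η) * α ≤ 2 * α := by gcongr; linarith
    rw [Real.dist_eq, abs_lt]
    constructor
    · rw [lt_sub_iff_add_lt, lt_div_iff₀ hn0]
      nlinarith
    · rw [sub_lt_iff_lt_add, div_lt_iff₀ hn0]
      nlinarith
  have hc : Tendsto (fun n : ℕ => c / (n : ℝ)) atTop (𝓝 0) :=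
    tendsto_const_div_atTop_nhds_zero_nat c
  simpa [sub_div, div_eq_inv_mul, mul_sub] using hmain.sub hc

end

theorem mainTheorem5 {Ω : Type*} [MeasurableSpace Ω] (P : Measure Ω) [IsProbabilityMeasure P]
    (X : ℝ≥0 → Ω → ℝ) (α β lam : ℝ) (hα : 0 < α) (hlam : 0 < lam) (hβ0 : 0 < β) (hβ1 : β < 1)
    (hX : IsTemperedStableSubordinator P X α β lam) :
    ∀ᵐ ω ∂P, (∀ n : ℕ, 1 ≤ n → jumpCount X β n ω ≠ ∞) ∧
      Tendsto (fun n : ℕ => (1 / (n : ℝ)) * ∑ j ∈ Finset.Icc 1 n, (jumpCount X β j ω).toReal)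
        atTop (𝓝 α) := by
  have hη : ∀ q : ℕ, 0 < 1 / ((q : ℝ) + 1) ∧ 1 / ((q : ℝ) + 1) ≤ 1 := fun q =>
    ⟨by positivity, by
      rw [div_le_one (by positivity)]; linarith [(Nat.cast_nonneg q : (0 : ℝ) ≤ q)]⟩
  have hup := ae_all_iff.2 fun q =>
    hX.ae_eventually_card_lt hα hlam hβ0 hβ1 (hη q).1 (hη q).2
  have hlow := ae_all_iff.2 fun q =>
    hX.ae_eventually_lt_ncard hα hlam hβ0 hβ1 (hη q).1 (hη q).2
  filter_upwards [hup, hlow] with ω hωup hωlow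
  -- Finiteness at one large index passes to smaller indices, whose levels are higher.
  have hfin : ∀ n : ℕ, (largeJumpTimes (fun t => X t ω) (phiLevel β n)).Finite := fun n => by
    obtain ⟨m, hm, hnm⟩ := ((hωup 0).and (eventually_gt_atTop n)).exists
    exact (Set.finite_and_ncard_lt_of_forall_finset hm).1.subset
      (largeJumpTimes_anti _ (phiLevel_lt hβ0 hnm).le)
  obtain ⟨hne, hsum⟩ := sum_jumpCount_toReal hβ0 X ω hfin
  refine ⟨fun n _ => hne n, ?_⟩
  simp_rw [hsum]
  exact tendsto_div_of_eventually_linear_bounds hα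
    (N := fun n => ((largeJumpTimes (fun t => X t ω) (phiLevel β n)).ncard : ℝ))
    (fun q => (hωup q).mono fun n hn => (Set.finite_and_ncard_lt_of_forall_finset hn).2)
    (fun q => (hωlow q).mono fun n hn => hn (hfin _)) _
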